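/- Let $(t_n)_{n\ge 0}$ be the sequence of integers defined by $t_0=1$, $t_1=5$ and $$t_{n+1}=(8n^2+12n+5)\,t_n-4n^2(2n+1)^2\,t_{n-1}\qquad(n\ge 1).$$ Then for every integer $n\ge 0$, $$t_n^2=-\big((2n+1)!\big)^2\sum_{k=0}^{2n+1}\binom{2n+1+k}{2k}\binom{2k}{k}^2\frac{1}{(-4)^k}\sum_{i=1}^{k}\frac{1}{(2i-1)^2}$$ and also $$t_n^2=-\big((2n+1)!\big)^2\sum_{k=0}^{2n+1}\binom{2n+1+k}{2k}\binom{2k}{k}^2\frac{1}{(-4)^k}\Big(\sum_{i=1}^{k}\frac{1}{2i-1}\Big)^2,$$ where an empty sum is $0$. -/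

import Mathlib

/-- The integer sequence given by `t 0 = 1`, `t 1 = 5` and
`t (m + 1) = (8 m ^ 2 + 12 m + 5) t m - 4 m ^ 2 (2 m + 1) ^ 2 t (m - 1)` for `m ≥ 1`
(the third clause below is this recurrence with `m = n + 1`). -/
def tSeq : ℕ → ℤ
  | 0 => 1
  | 1 => 5
  | n + 2 =>
      (8 * ((n : ℤ) + 1) ^ 2 + 12 * ((n : ℤ) + 1) + 5) * tSeq (n + 1)
        - 4 * ((n : ℤ) + 1) ^ 2 * (2 * ((n : ℤ) + 1) + 1) ^ 2 * tSeq n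

/-! Write S_N(f) for the weighted sum, O_j for the odd harmonic numbers, p_n = (2n choose n)/4^n and
u_n = t_n/(2n+1)!. Summation by parts against a contiguity relation of the weights links S_{N+2}(f)
and S_N(f) to S_{N+1}((2k+1)Δf), and (2k+1)Δ simplifies each f needed: it sends 1 to 0, O_1 to 1,
O_1² - O_2 to 2·O_1, and O_2 to 1/(2k+1). Hence S_N(1) vanishes for odd N and is p_n² for N = 2n,
S_N(O_1) vanishes for even N, and S_N(O_1² - O_2) vanishes for odd N, so the two formulas are
equivalent. For O_2, the sum S_{2n+2}(1/(2k+1)) is evaluated through p_{n+1} and u_n. The relation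
(2n+3)u_{n+1} = (2n+2)u_n + p_{n+1}, once squared, then shows that -u_n² obeys the same recurrence
as S_{2n+1}(O_2). -/

/-- The weight `(N + k choose 2k) (2k choose k)² / (-4)^k`. -/
def weight (N k : ℕ) : ℚ :=
  (Nat.choose (N + k) (2 * k) : ℚ) * (Nat.choose (2 * k) k : ℚ) ^ 2 * (1 / (-4 : ℚ) ^ k)

/-- The weighted sum `∑ k ≤ N, weight N k * f k`. -/
def weightedSum (N : ℕ) (f : ℕ → ℚ) : ℚ :=
  ∑ k ∈ Finset.range (N + 1), weight N k * f k

/-- The odd harmonic number of exponent `j`. -/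
def oddHarmonic (j k : ℕ) : ℚ :=
  ∑ i ∈ Finset.Icc 1 k, 1 / (2 * (i : ℚ) - 1) ^ j

theorem oddHarmonic_zero (j : ℕ) : oddHarmonic j 0 = 0 := by simp [oddHarmonic]

theorem oddHarmonic_succ (j k : ℕ) :
    oddHarmonic j (k + 1) = oddHarmonic j k + 1 / (2 * (k : ℚ) + 1) ^ j := by
  unfold oddHarmonic
  rw [Finset.sum_Icc_succ_top (by omega)]
  push_cast
  ring_nf

theorem weight_zero_right (N : ℕ) : weight N 0 = 1 := by simp [weight]

theorem weight_eq_zero {N k : ℕ} (h : N < k) : weight N k = 0 := by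
  simp [weight, Nat.choose_eq_zero_of_lt (show N + k < 2 * k by omega)]

theorem weightedSum_eq_sum_range {N K : ℕ} (h : N < K) (f : ℕ → ℚ) :
    weightedSum N f = ∑ k ∈ Finset.range K, weight N k * f k := by
  refine Finset.sum_subset (Finset.range_mono h) fun k _ hk => ?_
  rw [weight_eq_zero (by simpa using hk), zero_mul]

theorem cast_choose_succ_right_mul (m j : ℕ) :
    (Nat.choose m (j + 1) : ℚ) * (j + 1) = Nat.choose m j * ((m : ℚ) - j) := by
  rcases le_or_gt j m with h | h
  · have := Nat.choose_succ_right_eq m j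
    rw [← Nat.cast_sub h]
    exact_mod_cast this
  · simp [Nat.choose_eq_zero_of_lt h, Nat.choose_eq_zero_of_lt (show m < j + 1 by omega)]

theorem cast_choose_succ_succ_mul (m j : ℕ) :
    (Nat.choose (m + 1) (j + 1) : ℚ) * (j + 1) = (m + 1) * Nat.choose m j := by
  exact_mod_cast (Nat.add_one_mul_choose_eq m j).symm

theorem cast_choose_two_mul_succ (k : ℕ) :
    (Nat.choose (2 * (k + 1)) (k + 1) : ℚ) = 2 * (2 * k + 1) / (k + 1) * Nat.choose (2 * k) k := by
  have h : ((k : ℚ) + 1) * Nat.choose (2 * (k + 1)) (k + 1)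
      = 2 * (2 * k + 1) * Nat.choose (2 * k) k := by
    exact_mod_cast Nat.succ_mul_centralBinom_succ k
  field_simp
  linarith

theorem weight_succ_left_mul (N k : ℕ) :
    ((N : ℚ) + 1 - k) * weight (N + 1) k = (N + 1 + k) * weight N k := by
  have h1 := cast_choose_succ_right_mul (N + k + 1) (2 * k)
  have h2 := cast_choose_succ_succ_mul (N + k) (2 * k)
  unfold weight
  rw [show N + 1 + k = N + k + 1 by ring]
  push_cast at h1 h2
  linear_combination ((Nat.choose (2 * k) k : ℚ) ^ 2 * (1 / (-4 : ℚ) ^ k)) * (h2 - h1)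

/-- The contiguity relation behind the telescoping. -/
theorem weight_contiguous (N k : ℕ) :
    ((N : ℚ) + 2) ^ 2 * weight (N + 2) (k + 1) - ((N : ℚ) + 1) ^ 2 * weight N (k + 1)
      = (2 * N + 3) * ((2 * k + 3) * weight (N + 1) (k + 1) - (2 * k + 1) * weight (N + 1) k) := by
  have hk1 : ((k : ℚ) + 1) ≠ 0 := by positivity
  have hk2 : (2 * (k : ℚ) + 1) ≠ 0 := by positivity
  -- All binomials are reduced to rational multiples of (N+k+1 choose 2k), leaving a rational
  -- function identity.
  have a0 : (Nat.choose (N + k + 1) (2 * k + 1) : ℚ)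
      = Nat.choose (N + k + 1) (2 * k) * (N + 1 - k) / (2 * k + 1) := by
    have := cast_choose_succ_right_mul (N + k + 1) (2 * k)
    push_cast at this
    rw [eq_div_iff hk2]
    linarith
  have a1 : (Nat.choose (N + k + 1) (2 * k + 2) : ℚ)
      = Nat.choose (N + k + 1) (2 * k) * (N + 1 - k) * (N - k) / ((2 * k + 1) * (2 * (k + 1))) := by
    have := cast_choose_succ_right_mul (N + k + 1) (2 * k + 1)
    rw [a0] at this
    push_cast at this
    field_simp at this ⊢
    linarith
  have a2 : (Nat.choose (N + k + 2) (2 * k + 2) : ℚ)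
      = Nat.choose (N + k + 1) (2 * k) * (N + 1 - k) * (N + k + 2)
        / ((2 * k + 1) * (2 * (k + 1))) := by
    have := cast_choose_succ_succ_mul (N + k + 1) (2 * k + 1)
    rw [a0] at this
    push_cast at this
    field_simp at this ⊢
    linarith
  have a3 : (Nat.choose (N + k + 3) (2 * k + 2) : ℚ)
      = Nat.choose (N + k + 1) (2 * k) * (N + k + 2) * (N + k + 3)
        / ((2 * k + 1) * (2 * (k + 1))) := by
    have h1 := cast_choose_succ_succ_mul (N + k + 2) (2 * k + 1)
    have h2 := cast_choose_succ_succ_mul (N + k + 1) (2 * k)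
    have h3 : (Nat.choose (N + k + 2) (2 * k + 1) : ℚ)
        = (N + k + 2) * Nat.choose (N + k + 1) (2 * k) / (2 * k + 1) := by
      rw [eq_div_iff hk2]
      push_cast at h2
      linarith
    rw [h3] at h1
    push_cast at h1
    field_simp at h1 ⊢
    linarith
  unfold weight
  rw [cast_choose_two_mul_succ, show N + 2 + (k + 1) = N + k + 3 by ring,
    show N + 1 + (k + 1) = N + k + 2 by ring, show N + (k + 1) = N + k + 1 by ring,
    show N + 1 + k = N + k + 1 by ring, show 2 * (k + 1) = 2 * k + 2 by ring, a1, a2, a3, pow_succ]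
  field_simp
  ring

theorem weightedSum_recurrence (N : ℕ) (f : ℕ → ℚ) :
    ((N : ℚ) + 2) ^ 2 * weightedSum (N + 2) f - ((N : ℚ) + 1) ^ 2 * weightedSum N f
      = -((2 * N + 3) * weightedSum (N + 1) fun k => (2 * k + 1) * (f (k + 1) - f k)) := by
  -- Abel summation truncated at K leaves only a boundary term.
  have partial_sum (K : ℕ) :
      ((N : ℚ) + 2) ^ 2 * ∑ k ∈ Finset.range (K + 1), weight (N + 2) k * f k
        - ((N : ℚ) + 1) ^ 2 * ∑ k ∈ Finset.range (K + 1), weight N k * f k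
        + (2 * N + 3) * ∑ k ∈ Finset.range (K + 1),
          weight (N + 1) k * ((2 * k + 1) * (f (k + 1) - f k))
        = (2 * N + 3) * ((2 * K + 1) * weight (N + 1) K * f (K + 1)) := by
    induction K with
    | zero => simp [weight_zero_right]; ring
    | succ K ih =>
      rw [Finset.sum_range_succ, Finset.sum_range_succ _ (K + 1),
        Finset.sum_range_succ _ (K + 1)]
      have := weight_contiguous N K
      push_cast
      linear_combination ih + f (K + 1) * this
  -- This cutoff covers the support of all three weights, and the boundary term carries `weight (N +
  -- 1) (N + 2) = 0`.
  have h := partial_sum (N + 2)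
  rw [weight_eq_zero (show N + 1 < N + 2 by omega),
    ← weightedSum_eq_sum_range (by omega), ← weightedSum_eq_sum_range (by omega),
    ← weightedSum_eq_sum_range (N := N + 1) (by omega)
      (fun k => (2 * (k : ℚ) + 1) * (f (k + 1) - f k))] at h
  linear_combination h

theorem weightedSum_zero_left (f : ℕ → ℚ) : weightedSum 0 f = f 0 := by
  simp [weightedSum, weight_zero_right]

theorem weightedSum_one_left (f : ℕ → ℚ) : weightedSum 1 f = f 0 - f 1 := by
  simp [weightedSum, Finset.sum_range_succ, weight]
  ring

theorem weightedSum_congr {N : ℕ} {f g : ℕ → ℚ} (h : ∀ k, f k = g k) :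
    weightedSum N f = weightedSum N g := by
  rw [funext h]

theorem weightedSum_const_recurrence (N : ℕ) :
    ((N : ℚ) + 2) ^ 2 * weightedSum (N + 2) (fun _ => 1)
      = ((N : ℚ) + 1) ^ 2 * weightedSum N (fun _ => 1) := by
  have h := weightedSum_recurrence N (fun _ => 1)
  have h0 : weightedSum (N + 1) (fun k => (2 * (k : ℚ) + 1) * (1 - 1)) = 0 := by
    simp [weightedSum]
  rw [h0] at h
  linear_combination h

theorem weightedSum_const_odd (n : ℕ) : weightedSum (2 * n + 1) (fun _ => 1) = 0 := by
  induction n with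
  | zero => simp [weightedSum_one_left]
  | succ n ih =>
    have h := weightedSum_const_recurrence (2 * n + 1)
    rw [ih, mul_zero] at h
    exact (mul_eq_zero.mp h).resolve_left (by positivity)

/-- The normalized central binomial coefficient `(2n choose n) / 4^n`. -/
def normCentralBinom (n : ℕ) : ℚ := (Nat.choose (2 * n) n : ℚ) / 4 ^ n

theorem normCentralBinom_succ (n : ℕ) :
    (2 * (n : ℚ) + 2) * normCentralBinom (n + 1) = (2 * n + 1) * normCentralBinom n := by
  unfold normCentralBinom
  rw [cast_choose_two_mul_succ, pow_succ]
  field_simp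
  ring

theorem weightedSum_const_even (n : ℕ) :
    weightedSum (2 * n) (fun _ => 1) = normCentralBinom n ^ 2 := by
  induction n with
  | zero => simp [weightedSum_zero_left, normCentralBinom]
  | succ n ih =>
    have h := weightedSum_const_recurrence (2 * n)
    rw [ih] at h
    push_cast at h
    have hp := normCentralBinom_succ n
    have hne : (2 * (n : ℚ) + 2) ^ 2 ≠ 0 := by positivity
    apply mul_left_cancel₀ hne
    rw [show 2 * (n + 1) = 2 * n + 2 by ring, h, ← mul_pow, ← mul_pow, hp]

theorem weightedSum_oddHarmonic_even (n : ℕ) :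
    weightedSum (2 * n) (oddHarmonic 1) = 0 := by
  induction n with
  | zero => simp [weightedSum_zero_left, oddHarmonic_zero]
  | succ n ih =>
    have h := weightedSum_recurrence (2 * n) (oddHarmonic 1)
    rw [weightedSum_congr (g := fun _ => 1) (N := 2 * n + 1), weightedSum_const_odd, ih] at h
    · simp only [mul_zero, neg_zero, sub_zero] at h
      exact (mul_eq_zero.mp h).resolve_left (by positivity)
    · intro k
      rw [oddHarmonic_succ]
      field_simp
      ring

theorem weightedSum_const_mul (N : ℕ) (a : ℚ) (f : ℕ → ℚ) :
    weightedSum N (fun k => a * f k) = a * weightedSum N f := by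
  unfold weightedSum
  rw [Finset.mul_sum]
  exact Finset.sum_congr rfl fun k _ => by ring

theorem weightedSum_oddHarmonic_sq_sub_odd (n : ℕ) :
    weightedSum (2 * n + 1) (fun k => oddHarmonic 1 k ^ 2 - oddHarmonic 2 k) = 0 := by
  induction n with
  | zero => simp [weightedSum_one_left, oddHarmonic_zero, oddHarmonic_succ]
  | succ n ih =>
    have h := weightedSum_recurrence (2 * n + 1) (fun k => oddHarmonic 1 k ^ 2 - oddHarmonic 2 k)
    rw [weightedSum_congr (g := fun k => 2 * oddHarmonic 1 k) (N := 2 * n + 1 + 1),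
      weightedSum_const_mul, show 2 * n + 1 + 1 = 2 * (n + 1) by ring,
      weightedSum_oddHarmonic_even, ih] at h
    · simp only [mul_zero, neg_zero, sub_zero] at h
      exact (mul_eq_zero.mp h).resolve_left (by positivity)
    · intro k
      simp only [oddHarmonic_succ]
      field_simp
      ring

/-- Holds termwise: by `weight_succ_left_mul`, (2N+3)w_{N+1} - (2N+1)w_N = (2k+1)(w_N + w_{N+1}),
which cancels the denominator. -/
theorem weightedSum_inv_recurrence (N : ℕ) :
    (2 * (N : ℚ) + 3) * weightedSum (N + 1) (fun k => 1 / (2 * k + 1))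
      - (2 * N + 1) * weightedSum N (fun k => 1 / (2 * k + 1))
      = weightedSum N (fun _ => 1) + weightedSum (N + 1) (fun _ => 1) := by
  simp only [weightedSum_eq_sum_range (show N < N + 2 by omega),
    weightedSum_eq_sum_range (show N + 1 < N + 2 by omega), Finset.mul_sum]
  rw [← Finset.sum_sub_distrib, ← Finset.sum_add_distrib]
  refine Finset.sum_congr rfl fun k _ => ?_
  have h := weight_succ_left_mul N k
  field_simp
  linear_combination 2 * h

theorem weightedSum_inv_even_recurrence (n : ℕ) :
    (4 * (n : ℚ) + 5) * weightedSum (2 * n + 2) (fun k => 1 / (2 * k + 1))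
      - (4 * n + 1) * weightedSum (2 * n) (fun k => 1 / (2 * k + 1))
      = normCentralBinom n ^ 2 + normCentralBinom (n + 1) ^ 2 := by
  have h1 := weightedSum_inv_recurrence (2 * n)
  have h2 := weightedSum_inv_recurrence (2 * n + 1)
  have h3 := weightedSum_const_even (n + 1)
  rw [show 2 * (n + 1) = 2 * n + 1 + 1 by ring] at h3
  rw [weightedSum_const_even, weightedSum_const_odd] at h1
  rw [h3, weightedSum_const_odd] at h2
  push_cast at h1 h2
  linear_combination h1 + h2

/-- The sequence `tSeq n / (2n + 1)!`. -/
def normTSeq (n : ℕ) : ℚ := (tSeq n : ℚ) / (Nat.factorial (2 * n + 1) : ℚ)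

theorem normTSeq_recurrence (n : ℕ) :
    (2 * (n : ℚ) + 4) * (2 * n + 5) * normTSeq (n + 2)
      = (8 * (n + 1) ^ 2 + 12 * (n + 1) + 5) * normTSeq (n + 1)
        - (2 * n + 2) * (2 * n + 3) * normTSeq n := by
  unfold normTSeq
  have hf : (Nat.factorial (2 * n + 1) : ℚ) ≠ 0 := by positivity
  rw [show 2 * (n + 2) + 1 = 2 * n + 1 + 1 + 1 + 1 + 1 by ring,
    show 2 * (n + 1) + 1 = 2 * n + 1 + 1 + 1 by ring]
  simp only [Nat.factorial_succ (2 * n + 1 + 1 + 1 + 1), Nat.factorial_succ (2 * n + 1 + 1 + 1),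
    Nat.factorial_succ (2 * n + 1 + 1), Nat.factorial_succ (2 * n + 1), tSeq]
  push_cast
  field_simp
  ring

/-- The second-order recurrence factors: d_n = (2n+3)u_{n+1} - (2n+2)u_n satisfies (2n+4)d_{n+1} =
(2n+3)d_n, which is also the recurrence of p_{n+1}. -/
theorem normTSeq_succ (n : ℕ) :
    (2 * (n : ℚ) + 3) * normTSeq (n + 1)
      = (2 * n + 2) * normTSeq n + normCentralBinom (n + 1) := by
  induction n with
  | zero => norm_num [normTSeq, tSeq, normCentralBinom, Nat.factorial]
  | succ n ih =>
    have h := normTSeq_recurrence n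
    have hp := normCentralBinom_succ (n + 1)
    have hne : (2 * (n : ℚ) + 4) ≠ 0 := by positivity
    apply mul_left_cancel₀ hne
    push_cast at hp ⊢
    linear_combination h - hp + (2 * (n : ℚ) + 3) * ih

theorem weightedSum_inv_even (n : ℕ) :
    (4 * (n : ℚ) + 5) * weightedSum (2 * n + 2) (fun k => 1 / (2 * k + 1))
      = normCentralBinom (n + 1) * (normCentralBinom (n + 1) + (4 * n + 4) * normTSeq n) := by
  induction n with
  | zero =>
    have h := weightedSum_inv_even_recurrence 0
    rw [weightedSum_zero_left] at h
    norm_num [normTSeq, tSeq, normCentralBinom] at h ⊢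
    linarith
  | succ n ih =>
    have h := weightedSum_inv_even_recurrence (n + 1)
    have hp := normCentralBinom_succ (n + 1)
    have ht := normTSeq_succ n
    rw [show 2 * (n + 1) = 2 * n + 2 by ring] at h ⊢
    push_cast at h hp ⊢
    linear_combination h + ih - 2 * normCentralBinom (n + 1) * ht
      - 2 * normTSeq (n + 1) * hp

theorem weightedSum_oddHarmonic_two_odd (n : ℕ) :
    weightedSum (2 * n + 1) (oddHarmonic 2) = -normTSeq n ^ 2 := by
  induction n with
  | zero => simp [weightedSum_one_left, oddHarmonic_zero, oddHarmonic_succ, normTSeq, tSeq]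
  | succ n ih =>
    have h := weightedSum_recurrence (2 * n + 1) (oddHarmonic 2)
    rw [weightedSum_congr (g := fun k => 1 / (2 * (k : ℚ) + 1)) (N := 2 * n + 1 + 1), ih] at h
    · have hE := weightedSum_inv_even n
      have ht := normTSeq_succ n
      have hne : (2 * (n : ℚ) + 3) ^ 2 ≠ 0 := by positivity
      apply mul_left_cancel₀ hne
      rw [show 2 * (n + 1) + 1 = 2 * n + 1 + 2 by ring]
      push_cast at h ⊢
      -- The factor on `ht` is the sum of its two sides, so the product is `ht` squared on both
      -- sides.
      linear_combination h - hE + ((2 * n + 3) * normTSeq (n + 1) + (2 * n + 2) * normTSeq n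
        + normCentralBinom (n + 1)) * ht
    · intro k
      simp only [oddHarmonic_succ]
      field_simp
      ring

theorem weightedSum_oddHarmonic_one_sq_odd (n : ℕ) :
    weightedSum (2 * n + 1) (fun k => oddHarmonic 1 k ^ 2) = -normTSeq n ^ 2 := by
  have h := weightedSum_oddHarmonic_sq_sub_odd n
  rw [← weightedSum_oddHarmonic_two_odd]
  unfold weightedSum at h ⊢
  simpa only [mul_sub, Finset.sum_sub_distrib, sub_eq_zero] using h

theorem tSeq_sq_eq (n : ℕ) {S : ℚ} (h : S = -normTSeq n ^ 2) :
    (tSeq n : ℚ) ^ 2 = -((Nat.factorial (2 * n + 1) : ℚ) ^ 2 * S) := by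
  have hf : (Nat.factorial (2 * n + 1) : ℚ) ≠ 0 := by positivity
  rw [h, normTSeq]
  field_simp

theorem theorem3p2 (n : ℕ) :
    (tSeq n : ℚ) ^ 2 =
        -((Nat.factorial (2 * n + 1) : ℚ) ^ 2 *
          ∑ k ∈ Finset.range (2 * n + 2),
            (Nat.choose (2 * n + 1 + k) (2 * k) : ℚ) * (Nat.choose (2 * k) k : ℚ) ^ 2 *
              (1 / (-4 : ℚ) ^ k) *
              ∑ i ∈ Finset.Icc 1 k, 1 / (2 * (i : ℚ) - 1) ^ 2) ∧
    (tSeq n : ℚ) ^ 2 =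
        -((Nat.factorial (2 * n + 1) : ℚ) ^ 2 *
          ∑ k ∈ Finset.range (2 * n + 2),
            (Nat.choose (2 * n + 1 + k) (2 * k) : ℚ) * (Nat.choose (2 * k) k : ℚ) ^ 2 *
              (1 / (-4 : ℚ) ^ k) *
              (∑ i ∈ Finset.Icc 1 k, 1 / (2 * (i : ℚ) - 1)) ^ 2) := by
  refine ⟨tSeq_sq_eq n (weightedSum_oddHarmonic_two_odd n), tSeq_sq_eq n ?_⟩
  have h := weightedSum_oddHarmonic_one_sq_odd n
  simp only [weightedSum, weight, oddHarmonic, pow_one] at h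
  exact h
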